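/- Let $G$ be a finite Hamiltonian group, that is, a finite nonabelian group all of whose subgroups are normal. Then there is exactly one (unordered) set $\{H_1,H_2,H_3\}$ of three proper subgroups of $G$ with $G=H_1\cup H_2\cup H_3$ if and only if $G\cong Q_8\times A$ for some finite abelian group $A$ of odd order, where $Q_8$ is the quaternion group of order $8$. -/

import Mathlib

universe u

/-- A group is Hamiltonian if it is nonabelian and all of its subgroups are normal. -/
def IsHamiltonianGroup (G : Type*) [Group G] : Prop :=
  (∃ a b : G, a * b ≠ b * a) ∧ ∀ H : Subgroup G, H.Normal

/-- An (unordered) covering of `G` with three proper subgroups: a set of three proper subgroups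
whose union is `G`. -/
def IsThreeSubgroupCovering {G : Type*} [Group G] (S : Finset (Subgroup G)) : Prop :=
  S.card = 3 ∧ (∀ H ∈ S, H ≠ ⊤) ∧ (⋃ H ∈ S, (H : Set G)) = Set.univ

/-! A noncommuting pair `a`, `b` of minimal total order generates a copy of Q₈
(`exists_isQuaternionPair`). Let C be the centralizer of the pair. Conjugation by any element of G
fixes or inverts each of `a` and `b`, so G = C ∪ aC ∪ bC ∪ abC, and the centralizers of `a`, `b` and
`a * b` always cover G.

Members of a covering have index 2 (`Subgroup.index_eq_two_of_cover`), and two distinct subgroups of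
index 2 lie in a common covering. Hence the covering is unique exactly when every subgroup of index
2 contains C.

This means that `a ^ 2` is the only involution of C. Indeed C is abelian and its elements of 2-power
order square to 1. With one involution, C is ⟨a²⟩ times its odd part, which consists of squares, and
squares lie in every subgroup of index 2. Conversely, an involution of C lying in all subgroups of
index 2 is a product of squares, so it is c² or a²c² with c in C, which forces c² = 1. Having one
involution in C is equivalent to G being Q₈ times an odd abelian group. -/

section Commutator

variable {G : Type*} [Group G] {a b c : G}

lemma mul_pow_of_mul_eq_mul_mul (h : b * a = c * a * b) (hca : Commute c a) (m : ℕ) :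
    b * a ^ m = c ^ m * a ^ m * b := by
  induction m with
  | zero => simp
  | succ m ih =>
    rw [pow_succ a, ← mul_assoc, ih, mul_assoc, h, pow_succ c]
    simp only [mul_assoc]
    congr 1
    simp only [← mul_assoc]
    rw [(hca.pow_right m).eq]

lemma pow_mul_of_mul_eq_mul_mul (h : b * a = c * a * b) (hcb : Commute c b) (m : ℕ) :
    b ^ m * a = c ^ m * a * b ^ m := by
  induction m with
  | zero => simp
  | succ m ih =>
    rw [pow_succ' b, mul_assoc, ih, pow_succ c]
    simp only [← mul_assoc]
    rw [← (hcb.pow_left m).eq, mul_assoc (c ^ m) b a, h]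
    simp only [mul_assoc]

/-- Collection in class 2: each of the n(n-1)/2 exchanges of a `b` with a later `a` costs one factor
`c`. -/
lemma mul_pow_eq_of_mul_eq_mul_mul (h : b * a = c * a * b) (hca : Commute c a)
    (hcb : Commute c b) (n : ℕ) :
    (a * b) ^ n = a ^ n * b ^ n * c ^ n.choose 2 := by
  induction n with
  | zero => simp
  | succ n ih =>
    have hc : Commute (c ^ n.choose 2) (a * b) := (hca.mul_right hcb).pow_left _
    rw [pow_succ, ih, mul_assoc, hc.eq, Nat.choose_succ_succ' n 1, Nat.choose_one_right, pow_add c]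
    have h1 : a ^ n * b ^ n * (a * b) = a ^ (n + 1) * b ^ (n + 1) * c ^ n := by
      rw [mul_assoc (a ^ n), ← mul_assoc (b ^ n), pow_mul_of_mul_eq_mul_mul h hcb, pow_succ a,
        pow_succ b, (hca.pow_left n).eq]
      simp only [mul_assoc]
      rw [← mul_assoc (b ^ n), ← pow_succ, ((hcb.pow_left n).pow_right _).eq]
    rw [← mul_assoc (a ^ n * b ^ n), h1, mul_assoc _ (c ^ n)]

end Commutator

/-! ### Existence of a quaternion pair -/

/-- Generators of a quaternion subgroup of order `8`. -/
structure IsQuaternionPair {G : Type*} [Group G] (a b : G) : Prop where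
  sq_ne_one : a ^ 2 ≠ 1
  pow_four : a ^ 4 = 1
  sq_eq : b ^ 2 = a ^ 2
  inv_left : SemiconjBy b a a⁻¹

/-- An element of order dividing `p` of a cyclic group of order `p ^ (n + 1)`. -/
lemma mem_zpowers_pow_of_pow_eq_one {G : Type*} [Group G] {a c : G} {p n : ℕ} (hp : p.Prime)
    (ha : orderOf a = p ^ (n + 1)) (hc : c ∈ Subgroup.zpowers a) (hcp : c ^ p = 1) :
    c ∈ Subgroup.zpowers (a ^ p ^ n) := by
  obtain ⟨j, rfl⟩ := hc
  simp only at hcp ⊢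
  rw [← zpow_natCast, ← zpow_mul, ← orderOf_dvd_iff_zpow_eq_one, ha, pow_succ] at hcp
  push_cast at hcp
  obtain ⟨k, rfl⟩ := Int.dvd_of_mul_dvd_mul_right (by exact_mod_cast hp.ne_zero) hcp
  exact ⟨k, by simp [zpow_mul, ← zpow_natCast]⟩

lemma zpowers_eq_of_mem_of_orderOf_eq {G : Type*} [Group G] [Finite G] {x y : G}
    (hx : x ∈ Subgroup.zpowers y) (h : orderOf x = orderOf y) :
    Subgroup.zpowers x = Subgroup.zpowers y :=
  Subgroup.eq_of_le_of_card_ge (by simpa using hx) (by simp [Nat.card_zpowers, h])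

/-- For odd p the binomial is divisible by p^β; for p = 2 it is 2^(β-1) times an odd number. -/
lemma eq_two_of_not_dvd_choose_two {p α β : ℕ} (hp : p.Prime) (hαβ : β ≤ α) (hβ : β ≠ 0)
    (h : ¬ p ∣ p ^ (α - β) * (p ^ β).choose 2) : p = 2 ∧ α = 1 ∧ β = 1 := by
  have h1 : α = β := by
    by_contra hne
    exact h (Dvd.dvd.mul_right (dvd_pow_self p (by omega)) _)
  subst h1
  simp only [Nat.sub_self, pow_zero, one_mul] at h
  obtain ⟨k, rfl⟩ := Nat.exists_eq_succ_of_ne_zero hβ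
  have h2 : (p ^ (k + 1)).choose 2 * 2 = p ^ (k + 1) * (p ^ (k + 1) - 1) := by
    rw [Nat.choose_two_right, Nat.div_mul_cancel (Nat.even_mul_pred_self _).two_dvd]
  have hp2 : p = 2 := by
    have : p ∣ (p ^ (k + 1)).choose 2 * 2 := h2 ▸ Dvd.dvd.mul_right (dvd_pow_self p (by omega)) _
    exact (Nat.prime_dvd_prime_iff_eq hp Nat.prime_two).1 ((hp.dvd_mul.1 this).resolve_left h)
  subst hp2
  have h3 : (2 ^ (k + 1)).choose 2 = 2 ^ k * (2 ^ (k + 1) - 1) := by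
    rw [pow_succ] at h2 ⊢
    apply Nat.eq_of_mul_eq_mul_right (show 0 < 2 by norm_num)
    rw [h2]; ring
  have hk : k = 0 := by
    by_contra hk
    exact h (h3 ▸ Dvd.dvd.mul_right (dvd_pow_self 2 hk) _)
  simp [hk]

/-- Let `a`, `b` be a noncommuting pair with `orderOf a + orderOf b` minimal. Then `a` and `b`
generate a quaternion group. -/
lemma isQuaternionPair_of_minimal {G : Type*} [Group G] [Finite G]
    (hN : ∀ H : Subgroup G, H.Normal) {a b : G} (hab : ¬ Commute a b)
    (hmin : ∀ x y : G, ¬ Commute x y → orderOf a + orderOf b ≤ orderOf x + orderOf y)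
    (hle : orderOf b ≤ orderOf a) : IsQuaternionPair a b := by
  obtain ⟨c, hc⟩ : ∃ c, c = b * a * b⁻¹ * a⁻¹ := ⟨_, rfl⟩
  have hba : b * a = c * a * b := by rw [hc]; group
  have hca : c ∈ Subgroup.zpowers a := by
    rw [hc]
    exact mul_mem ((hN _).conj_mem _ (Subgroup.mem_zpowers a) b)
      (inv_mem (Subgroup.mem_zpowers a))
  have hcb : c ∈ Subgroup.zpowers b := by
    have : c = b * (a * b⁻¹ * a⁻¹) := by rw [hc]; group
    rw [this]
    exact mul_mem (Subgroup.mem_zpowers b)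
      ((hN _).conj_mem _ (inv_mem (Subgroup.mem_zpowers b)) a)
  have cca : Commute c a := by
    obtain ⟨j, rfl⟩ := hca; exact (Commute.refl a).zpow_left j
  have ccb : Commute c b := by
    obtain ⟨j, rfl⟩ := hcb; exact (Commute.refl b).zpow_left j
  have hc1 : c ≠ 1 := by
    rintro rfl
    exact hab (by rw [one_mul] at hba; exact hba.symm)
  have hlt : ∀ (x : G) (q : ℕ), q.Prime → q ∣ orderOf x → orderOf (x ^ q) < orderOf x := by
    intro x q hq hd
    rw [orderOf_pow_of_dvd hq.ne_zero hd]
    exact Nat.div_lt_self (orderOf_pos x) hq.one_lt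
  -- By minimality `a ^ q` commutes with `b`, so `c ^ q = 1`.
  have hqa : ∀ q : ℕ, q.Prime → q ∣ orderOf a → q = orderOf c := by
    intro q hq hd
    have h1 : Commute (a ^ q) b := by
      by_contra h
      have := hmin _ _ h
      have := hlt a q hq hd
      omega
    have h2 := mul_pow_of_mul_eq_mul_mul hba cca q
    rw [h1.eq.symm] at h2
    have h3 : c ^ q = 1 := by
      rw [mul_assoc] at h2; exact (right_eq_mul.1 h2)
    exact (((Nat.dvd_prime hq).1 (orderOf_dvd_of_pow_eq_one h3)).resolve_left
      (by simpa using hc1)).symm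
  have hqb : ∀ q : ℕ, q.Prime → q ∣ orderOf b → q = orderOf c := by
    intro q hq hd
    have h1 : Commute a (b ^ q) := by
      by_contra h
      have := hmin _ _ h
      have := hlt b q hq hd
      omega
    have h2 := pow_mul_of_mul_eq_mul_mul hba ccb q
    rw [h1.eq.symm] at h2
    have h3 : c ^ q = 1 := by
      rw [mul_assoc] at h2; exact (right_eq_mul.1 h2)
    exact (((Nat.dvd_prime hq).1 (orderOf_dvd_of_pow_eq_one h3)).resolve_left
      (by simpa using hc1)).symm
  obtain ⟨p, hpc⟩ : ∃ p, p = orderOf c := ⟨_, rfl⟩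
  rw [← hpc] at hqa hqb
  have hb1 : orderOf b ≠ 1 := by
    intro h; rw [orderOf_eq_one_iff] at h; exact hab (h ▸ Commute.one_right a)
  have hp : p.Prime := by
    have h := Nat.minFac_prime hb1
    rwa [hqb _ h (Nat.minFac_dvd _)] at h
  have hcp : c ^ p = 1 := hpc ▸ pow_orderOf_eq_one c
  have hoa : ∃ n, orderOf a = p ^ n :=
    ⟨_, Nat.eq_prime_pow_of_unique_prime_dvd (orderOf_pos a).ne' (fun {d} hd h => hqa d hd h)⟩
  have hob : ∃ n, orderOf b = p ^ n :=
    ⟨_, Nat.eq_prime_pow_of_unique_prime_dvd (orderOf_pos b).ne' (fun {d} hd h => hqb d hd h)⟩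
  obtain ⟨α, hα⟩ := hoa
  obtain ⟨β, hβ⟩ := hob
  have hαβ : β ≤ α := by
    rw [hα, hβ] at hle
    exact (Nat.pow_le_pow_iff_right hp.one_lt).1 hle
  obtain ⟨β, rfl⟩ : ∃ n, β = n + 1 :=
    Nat.exists_eq_succ_of_ne_zero (by rintro rfl; exact hb1 (by simpa using hβ))
  obtain ⟨α, rfl⟩ : ∃ n, α = n + 1 := Nat.exists_eq_succ_of_ne_zero (by omega)
  have hβ0 : β ≠ 0 := by
    rintro rfl
    have h := zpowers_eq_of_mem_of_orderOf_eq hcb (by rw [← hpc, hβ]; simp)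
    have hb : b ∈ Subgroup.zpowers c := h ▸ Subgroup.mem_zpowers b
    obtain ⟨j, rfl⟩ := hb
    exact hab (cca.zpow_left j).symm
  have hcb' := mem_zpowers_pow_of_pow_eq_one hp hβ hcb hcp
  have hca' := mem_zpowers_pow_of_pow_eq_one hp hα hca hcp
  -- ⟨c⟩ is the subgroup of order p in both ⟨a⟩ and ⟨b⟩.
  have hbc : b ^ p ^ β ∈ Subgroup.zpowers (a ^ p ^ α) := by
    have h := zpowers_eq_of_mem_of_orderOf_eq hcb' (by
      rw [← hpc, orderOf_pow_of_dvd (pow_ne_zero _ hp.ne_zero), hβ, pow_succ,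
        Nat.mul_div_cancel_left _ (pow_pos hp.pos _)]
      rw [hβ]; exact pow_dvd_pow _ (by omega))
    have : b ^ p ^ β ∈ Subgroup.zpowers c := h ▸ Subgroup.mem_zpowers _
    exact (Subgroup.zpowers_le.2 hca') this
  obtain ⟨k, hk⟩ : ∃ k : ℕ, (a ^ p ^ α) ^ k = (b ^ p ^ β)⁻¹ := by
    have := inv_mem hbc
    rwa [← mem_powers_iff_mem_zpowers, Submonoid.mem_powers_iff] at this
  -- Chosen so that `a ^ m` and `b` have inverse `p ^ β`-th powers; the power of `a ^ m * b` then
  -- reduces to a power of `c`.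
  obtain ⟨m, hm⟩ : ∃ m, m = k * p ^ (α - β) := ⟨_, rfl⟩
  have hda : ¬ Commute a (a ^ m * b) := by
    intro h
    apply hab
    have := ((Commute.refl a).pow_right m).inv_right.mul_right h
    simpa using this
  have hd : (a ^ m * b) ^ p ^ β = (c ^ m) ^ (p ^ β).choose 2 := by
    rw [mul_pow_eq_of_mul_eq_mul_mul (mul_pow_of_mul_eq_mul_mul hba cca m)
      ((cca.pow_left m).pow_right m) (ccb.pow_left m)]
    have : (a ^ m) ^ p ^ β = (b ^ p ^ β)⁻¹ := by
      rw [← hk, ← pow_mul, ← pow_mul, hm, mul_assoc, ← pow_add, Nat.sub_add_cancel (by omega),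
        mul_comm]
    rw [this, inv_mul_cancel, one_mul]
  -- Otherwise `a ^ m * b` could replace `b` with smaller order.
  have hndvd : ¬ p ∣ p ^ (α - β) * (p ^ β).choose 2 := by
    rintro ⟨t, ht⟩
    have h1 : (a ^ m * b) ^ p ^ β = 1 := by
      rw [hd, ← pow_mul, hm, mul_assoc, ht, mul_comm, mul_assoc, pow_mul, hcp, one_pow]
    have h2 := orderOf_le_of_pow_eq_one (pow_pos hp.pos _) h1
    have h3 := hmin _ _ hda
    have h4 : p ^ β < p ^ (β + 1) := Nat.pow_lt_pow_right hp.one_lt (by omega)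
    omega
  obtain ⟨rfl, rfl, rfl⟩ := eq_two_of_not_dvd_choose_two hp (by omega) hβ0 hndvd
  have key : ∀ x : G, orderOf x = 2 ^ (1 + 1) → c ∈ Subgroup.zpowers (x ^ 2 ^ 1) → c = x ^ 2 := by
    rintro x hx ⟨j, hj⟩
    have h4 : x ^ 4 = 1 := by
      have := pow_orderOf_eq_one x; rwa [hx] at this
    simp only [pow_one] at hj
    have hx2 : (x ^ 2) ^ (2 : ℤ) = 1 := by
      rw [zpow_ofNat, ← pow_mul]; exact h4
    rcases Int.even_or_odd' j with ⟨i, rfl | rfl⟩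
    · rw [zpow_mul, hx2, one_zpow] at hj; exact absurd hj.symm hc1
    · rw [zpow_add, zpow_mul, hx2, one_zpow, one_mul, zpow_one] at hj; exact hj.symm
  have e1 := key a hα hca'
  have e2 := key b hβ hcb'
  have ha4 : a ^ 4 = 1 := by
    have := pow_orderOf_eq_one a; rwa [hα] at this
  refine ⟨e1 ▸ hc1, ha4, e2 ▸ e1, ?_⟩
  have : a⁻¹ = a ^ 3 := inv_eq_of_mul_eq_one_left (by rw [← pow_succ, ha4])
  rw [SemiconjBy, hba, e1, this, ← pow_succ]

lemma IsQuaternionPair.inv_right {G : Type*} [Group G] {a b : G} (h : IsQuaternionPair a b) :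
    SemiconjBy a b b⁻¹ := by
  have h1 : b * (a * b) = a := by
    rw [← mul_assoc, h.inv_left.eq, mul_assoc, ← sq, h.sq_eq, sq, inv_mul_cancel_left]
  rw [SemiconjBy, eq_inv_mul_iff_mul_eq, h1]

/-- A nonabelian finite group all of whose subgroups are normal contains a quaternion group. -/
theorem exists_isQuaternionPair {G : Type*} [Group G] [Finite G]
    (hN : ∀ H : Subgroup G, H.Normal) (hG : ∃ a b : G, ¬ Commute a b) :
    ∃ a b : G, IsQuaternionPair a b := by
  classical
  have hex : ∃ n, ∃ a b : G, ¬ Commute a b ∧ orderOf a + orderOf b = n := by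
    obtain ⟨a, b, h⟩ := hG; exact ⟨_, a, b, h, rfl⟩
  obtain ⟨a, b, hab, hn⟩ := Nat.find_spec hex
  have hmin : ∀ x y : G, ¬ Commute x y → orderOf a + orderOf b ≤ orderOf x + orderOf y :=
    fun x y h => hn ▸ Nat.find_min' hex ⟨x, y, h, rfl⟩
  rcases le_total (orderOf b) (orderOf a) with h | h
  · exact ⟨a, b, isQuaternionPair_of_minimal hN hab hmin h⟩
  · exact ⟨b, a, isQuaternionPair_of_minimal hN (fun h' => hab h'.symm)
      (fun x y h' => by have := hmin x y h'; omega) h⟩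

/-! ### Three-subgroup coverings and subgroups of index 2 -/

section IndexTwo

variable {G : Type*} [Group G]

lemma Subgroup.index_eq_two_of_mul_mem {H : Subgroup G} (hH : H ≠ ⊤)
    (h : ∀ x y, x ∉ H → y ∉ H → x * y ∈ H) : H.index = 2 := by
  obtain ⟨x, hx⟩ : ∃ x, x ∉ H := by
    by_contra! h'; exact hH ((Subgroup.eq_top_iff' H).2 h')
  rw [Subgroup.index_eq_two_iff_exists_notMem_and]
  exact ⟨x, hx, fun y => or_iff_not_imp_right.2 fun hy => h y x hy hx⟩

lemma Subgroup.exists_notMem_and_notMem {H K : Subgroup G} (hH : H ≠ ⊤) (hK : K ≠ ⊤) :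
    ∃ x, x ∉ H ∧ x ∉ K := by
  by_contra! h
  obtain ⟨x, hx⟩ : ∃ x, x ∉ H := by
    by_contra! h'; exact hH ((Subgroup.eq_top_iff' H).2 h')
  obtain ⟨y, hy⟩ : ∃ y, y ∉ K := by
    by_contra! h'; exact hK ((Subgroup.eq_top_iff' K).2 h')
  have hxK := h x hx
  have hyH : y ∈ H := by by_contra h'; exact hy (h y h')
  have h1 : x * y ∉ H := fun h' => hx ((mul_mem_cancel_right hyH).1 h')
  exact hy ((mul_mem_cancel_left hxK).1 (h _ h1))

/-- The members of a covering by three proper subgroups have index `2`. -/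
lemma Subgroup.index_eq_two_of_cover {H K L : Subgroup G} (hH : H ≠ ⊤) (hK : K ≠ ⊤) (hL : L ≠ ⊤)
    (hc : ∀ g, g ∈ H ∨ g ∈ K ∨ g ∈ L) : H.index = 2 := by
  obtain ⟨x, hxK, hxL⟩ := Subgroup.exists_notMem_and_notMem hK hL
  obtain ⟨y, hyH, hyL⟩ := Subgroup.exists_notMem_and_notMem hH hL
  obtain ⟨w, hwH, hwK⟩ := Subgroup.exists_notMem_and_notMem hH hK
  have hyK : y ∈ K := by have := hc y; tauto
  have hwL : w ∈ L := by have := hc w; tauto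
  have hKL : ∀ g, g ∈ K → g ∈ L → g ∈ H := fun g h1 h2 => by
    have h3 : x * g ∉ K := fun h => hxK ((mul_mem_cancel_right h1).1 h)
    have h4 : x * g ∉ L := fun h => hxL ((mul_mem_cancel_right h2).1 h)
    have hxH : x ∈ H := by have := hc x; tauto
    have h5 : x * g ∈ H := by have := hc (x * g); tauto
    exact (mul_mem_cancel_left hxH).1 h5
  have hmem : ∀ g, g ∉ K → g ∉ L → g ∈ H := fun g h1 h2 => by have := hc g; tauto
  -- Write gh = (gw⁻¹)(wh); both factors avoid K and L.
  have aux : ∀ (K L : Subgroup G) (w g h : G), (∀ g, g ∉ K → g ∉ L → g ∈ H) →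
      w ∈ L → w ∉ K → g ∈ K → g ∉ L → h ∈ K → h ∉ L → g * h ∈ H := by
    intro K L w g h hm hwL hwK hgK hgL hhK hhL
    have h1 : w * h ∈ H := hm _ (fun h' => hwK ((mul_mem_cancel_right hhK).1 h'))
      (fun h' => hhL ((mul_mem_cancel_left hwL).1 h'))
    have h2 : g * w⁻¹ ∈ H := hm _
      (fun h' => hwK (inv_mem_iff.1 ((mul_mem_cancel_left hgK).1 h')))
      (fun h' => hgL ((mul_mem_cancel_right (inv_mem hwL)).1 h'))
    simpa using mul_mem h2 h1
  refine Subgroup.index_eq_two_of_mul_mem hH fun g h hg hh => ?_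
  have hg' : (g ∈ K ∧ g ∉ L) ∨ (g ∈ L ∧ g ∉ K) := by have := hc g; have := hKL g; tauto
  have hh' : (h ∈ K ∧ h ∉ L) ∨ (h ∈ L ∧ h ∉ K) := by have := hc h; have := hKL h; tauto
  rcases hg' with ⟨g1, g2⟩ | ⟨g1, g2⟩ <;> rcases hh' with ⟨h1, h2⟩ | ⟨h1, h2⟩
  · exact aux K L w g h hmem hwL hwK g1 g2 h1 h2
  · exact hmem _ (fun h' => h2 ((mul_mem_cancel_left g1).1 h'))
      (fun h' => g2 ((mul_mem_cancel_right h1).1 h'))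
  · exact hmem _ (fun h' => g2 ((mul_mem_cancel_right h1).1 h'))
      (fun h' => h2 ((mul_mem_cancel_left g1).1 h'))
  · exact aux L K y g h (fun g h1 h2 => hmem g h2 h1) hyK hyL g1 g2 h1 h2

lemma IsThreeSubgroupCovering.index_eq_two {S : Finset (Subgroup G)}
    (hS : IsThreeSubgroupCovering S) {H : Subgroup G} (hH : H ∈ S) : H.index = 2 := by
  classical
  obtain ⟨hcard, hprop, hcov⟩ := hS
  have h2 : (S.erase H).card = 2 := by rw [Finset.card_erase_of_mem hH, hcard]
  obtain ⟨K, L, -, hKL⟩ := Finset.card_eq_two.1 h2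
  have hK : K ∈ S := Finset.mem_of_mem_erase (a := H) (by rw [hKL]; simp)
  have hL : L ∈ S := Finset.mem_of_mem_erase (a := H) (by rw [hKL]; simp)
  refine Subgroup.index_eq_two_of_cover (hprop H hH) (hprop K hK) (hprop L hL) fun g => ?_
  have hg : g ∈ (⋃ H ∈ S, (H : Set G)) := hcov ▸ Set.mem_univ g
  rw [← Finset.insert_erase hH, hKL] at hg
  simpa using hg

open Classical in
lemma isThreeSubgroupCovering_triple {H K L : Subgroup G} (hHK : H ≠ K) (hHL : H ≠ L)
    (hKL : K ≠ L) (hH : H ≠ ⊤) (hK : K ≠ ⊤) (hL : L ≠ ⊤) (hc : ∀ g, g ∈ H ∨ g ∈ K ∨ g ∈ L) :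
    IsThreeSubgroupCovering ({H, K, L} : Finset (Subgroup G)) := by
  refine ⟨Finset.card_eq_three.2 ⟨H, K, L, hHK, hHL, hKL, rfl⟩, by simp [hH, hK, hL], ?_⟩
  ext g
  simpa using hc g

/-- Two distinct subgroups of index `2` belong to a common covering. -/
lemma exists_isThreeSubgroupCovering_of_index_two {H K : Subgroup G} (hH : H.index = 2)
    (hK : K.index = 2) (hHK : H ≠ K) :
    ∃ S : Finset (Subgroup G), IsThreeSubgroupCovering S ∧ H ∈ S := by
  classical
  have hH' : H ≠ ⊤ := by rintro rfl; simp at hH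
  have hK' : K ≠ ⊤ := by rintro rfl; simp at hK
  -- The third subgroup is the complement of the symmetric difference of H and K.
  let L : Subgroup G :=
    { carrier := {g | g ∈ H ↔ g ∈ K}
      mul_mem' := fun {x y} hx hy => by
        simp only [Set.mem_ofPred_eq] at hx hy ⊢
        rw [Subgroup.mul_mem_iff_of_index_two hH, Subgroup.mul_mem_iff_of_index_two hK, hx, hy]
      one_mem' := by simp
      inv_mem' := fun {x} hx => by simpa using hx }
  have hL : ∀ g, g ∈ L ↔ (g ∈ H ↔ g ∈ K) := fun g => Iff.rfl
  refine ⟨{H, K, L}, isThreeSubgroupCovering_triple hHK ?_ ?_ hH' hK' ?_ ?_, by simp⟩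
  · intro h
    refine hK' ((Subgroup.eq_top_iff' K).2 fun g => ?_)
    have := hL g
    rw [← h] at this
    tauto
  · intro h
    refine hH' ((Subgroup.eq_top_iff' H).2 fun g => ?_)
    have := hL g
    rw [← h] at this
    tauto
  · intro h
    refine hHK (Subgroup.ext fun g => ?_)
    have := hL g
    simpa [h] using this
  · intro g
    have := hL g
    tauto

/-- In a finite group all of whose subgroups are normal, a subgroup containing all squares
is the intersection of the subgroups of index `2` containing it. -/
lemma exists_index_two_of_notMem [Finite G] (hN : ∀ H : Subgroup G, H.Normal) {N : Subgroup G}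
    (hsq : ∀ g : G, g ^ 2 ∈ N) {x : G} (hx : x ∉ N) :
    ∃ H : Subgroup G, H.index = 2 ∧ x ∉ H := by
  -- A subgroup maximal among those containing N and avoiding x has index 2.
  obtain ⟨H, hH⟩ := (Set.toFinite {H : Subgroup G | N ≤ H ∧ x ∉ H}).exists_maximal ⟨N, le_rfl, hx⟩
  obtain ⟨hNH, hxH⟩ := hH.prop
  have hx2 : x * x ∈ H := sq x ▸ hNH (hsq x)
  have := hN H
  have key : ∀ g, g ∉ H → x * g ∈ H := by
    intro g hg
    have h1 : x ∈ H ⊔ Subgroup.zpowers g := by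
      by_contra hx'
      have := hH.le_of_ge (y := H ⊔ Subgroup.zpowers g) ⟨hNH.trans le_sup_left, hx'⟩ le_sup_left
      exact hg (this (Subgroup.mem_sup_right (Subgroup.mem_zpowers g)))
    obtain ⟨y, hy, z, ⟨j, rfl⟩, hyz⟩ := Subgroup.mem_sup_of_normal_left.1 h1
    have hg2 : g ^ (2 : ℤ) ∈ H := by
      rw [zpow_ofNat]; exact hNH (hsq g)
    rcases Int.even_or_odd' j with ⟨i, rfl | rfl⟩
    · exact absurd (hyz ▸ mul_mem hy (by simpa only [zpow_mul] using zpow_mem hg2 i)) hxH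
    · rw [← hyz]
      simp only
      rw [zpow_add, zpow_one, zpow_mul, mul_assoc, mul_assoc, ← sq]
      exact mul_mem hy (mul_mem (zpow_mem hg2 i) (hNH (hsq g)))
  exact ⟨H, Subgroup.index_eq_two_iff_exists_notMem_and'.2
    ⟨x, hxH, fun g => or_iff_not_imp_right.2 (key g)⟩, hxH⟩

end IndexTwo

/-! ### The centralizer of a quaternion pair -/

section Dedekind

variable {G : Type*} [Group G]

lemma semiconjBy_self_or_inv (hN : ∀ H : Subgroup G, H.Normal) {x : G} (hx : x ^ 4 = 1) (g : G) :
    SemiconjBy g x x ∨ SemiconjBy g x x⁻¹ := by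
  have h := (hN (Subgroup.zpowers x)).conj_mem x (Subgroup.mem_zpowers x) g
  obtain ⟨k, hk⟩ := h
  simp only at hk
  have hx' : x ^ (4 : ℤ) = 1 := by rw [zpow_ofNat, hx]
  have hmod : x ^ k = x ^ (k % 4) := by
    conv_lhs => rw [← Int.emod_add_mul_ediv k 4, zpow_add, zpow_mul, hx', one_zpow, mul_one]
  have hs : SemiconjBy g x (x ^ (k % 4)) := by
    rw [← hmod, hk]; exact SemiconjBy.conj_mk g x
  have hr : k % 4 = 0 ∨ k % 4 = 1 ∨ k % 4 = 2 ∨ k % 4 = 3 := by omega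
  rcases hr with hr | hr | hr | hr <;> rw [hr] at hs
  · left
    rw [zpow_zero] at hs
    rw [hs.eq_one_iff.2 rfl]; exact SemiconjBy.one_right g
  · left; simpa using hs
  · left
    have h2 := hs.pow_right 2
    rw [zpow_ofNat, ← pow_mul, hx] at h2
    rw [zpow_ofNat, h2.eq_one_iff.2 rfl] at hs
    rw [hs.eq_one_iff.2 rfl]; exact SemiconjBy.one_right g
  · right
    have : x⁻¹ = x ^ (3 : ℤ) := by
      rw [zpow_ofNat]; exact inv_eq_of_mul_eq_one_left (by rw [← pow_succ, hx])
    rwa [this]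

namespace IsQuaternionPair

variable {a b : G}

lemma ne_inv_right (h : IsQuaternionPair a b) : b ≠ b⁻¹ := fun h' =>
  h.sq_ne_one (by rw [← h.sq_eq, sq]; exact mul_eq_one_iff_eq_inv.2 h')

lemma pow_four_right (h : IsQuaternionPair a b) : b ^ 4 = 1 := by
  rw [show 4 = 2 * 2 from rfl, pow_mul, h.sq_eq, ← pow_mul]; exact h.pow_four

lemma not_commute (h : IsQuaternionPair a b) : ¬ Commute a b := fun h' =>
  h.ne_inv_right (mul_right_cancel (h'.eq.symm.trans h.inv_right.eq))

lemma orderOf_left (h : IsQuaternionPair a b) : orderOf a = 4 := by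
  have := Fact.mk Nat.prime_two
  exact orderOf_eq_prime_pow (n := 1) (p := 2) h.sq_ne_one h.pow_four

lemma mul_sq (h : IsQuaternionPair a b) : (a * b) ^ 2 = a ^ 2 := by
  rw [sq, mul_assoc, ← mul_assoc b, h.inv_left.eq, mul_assoc, ← sq, h.sq_eq, sq,
    inv_mul_cancel_left]

lemma commute_sq_right (h : IsQuaternionPair a b) : Commute (a ^ 2) b := by
  rw [← h.sq_eq]; exact (Commute.refl b).pow_left 2

lemma mem_centralizer_pair {x : G} :
    x ∈ Subgroup.centralizer {a, b} ↔ Commute x a ∧ Commute x b := by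
  simp [Subgroup.mem_centralizer_iff, commute_iff_eq, eq_comm (a := x * _)]

lemma mem_centralizer_singleton {x : G} : x ∈ Subgroup.centralizer {a} ↔ Commute x a := by
  simp [Subgroup.mem_centralizer_iff, Commute, SemiconjBy, eq_comm]

/-- The four possible actions on the pair are realized by 1, a, b and ab. -/
lemma exists_mul_centralizer (h : IsQuaternionPair a b) (hN : ∀ H : Subgroup G, H.Normal) (g : G) :
    ∃ c ∈ Subgroup.centralizer {a, b}, g = c ∨ g = a * c ∨ g = b * c ∨ g = a * b * c := by
  have aux : ∀ {q x y : G}, SemiconjBy q x y → SemiconjBy g x y → Commute (q⁻¹ * g) x :=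
    fun hq hg => (SemiconjBy.inv_symm_left_iff.2 hq).mul_left hg
  simp only [mem_centralizer_pair]
  rcases semiconjBy_self_or_inv hN h.pow_four g with ha | ha <;>
    rcases semiconjBy_self_or_inv hN h.pow_four_right g with hb | hb
  · exact ⟨g, ⟨ha, hb⟩, .inl rfl⟩
  · exact ⟨a⁻¹ * g, ⟨aux (Commute.refl a) ha, aux h.inv_right hb⟩, by simp⟩
  · exact ⟨b⁻¹ * g, ⟨aux h.inv_left ha, aux (Commute.refl b) hb⟩, by simp⟩
  · refine ⟨(a * b)⁻¹ * g, ⟨aux ?_ ha, aux ?_ hb⟩, by simp [mul_assoc]⟩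
    · exact SemiconjBy.mul_left (Commute.refl a).inv_right h.inv_left
    · exact SemiconjBy.mul_left h.inv_right (Commute.refl b)

open Classical in
lemma isThreeSubgroupCovering (h : IsQuaternionPair a b) (hN : ∀ H : Subgroup G, H.Normal) :
    IsThreeSubgroupCovering ({Subgroup.centralizer {a}, Subgroup.centralizer {b},
      Subgroup.centralizer {a * b}} : Finset (Subgroup G)) := by
  have haa : a ∈ Subgroup.centralizer {a} := mem_centralizer_singleton.2 (.refl a)
  have hbb : b ∈ Subgroup.centralizer {b} := mem_centralizer_singleton.2 (.refl b)
  have hab : a ∉ Subgroup.centralizer {b} := fun h' =>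
    h.not_commute (mem_centralizer_singleton.1 h')
  have hba : b ∉ Subgroup.centralizer {a} := fun h' =>
    h.not_commute (mem_centralizer_singleton.1 h').symm
  have haab : a ∉ Subgroup.centralizer {a * b} := fun h' => h.not_commute (by
    simpa using (Commute.refl a).inv_right.mul_right (mem_centralizer_singleton.1 h'))
  have hbab : b ∉ Subgroup.centralizer {a * b} := fun h' => h.not_commute (Commute.symm (by
    simpa using (mem_centralizer_singleton.1 h').mul_right (Commute.refl b).inv_right))
  refine isThreeSubgroupCovering_triple (fun e => hab (e ▸ haa)) (fun e => haab (e ▸ haa))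
    (fun e => hbab (e ▸ hbb)) (fun e => hba (e ▸ Subgroup.mem_top b))
    (fun e => hab (e ▸ Subgroup.mem_top a)) (fun e => hbab (e ▸ Subgroup.mem_top b)) fun g => ?_
  simp only [mem_centralizer_singleton]
  rcases semiconjBy_self_or_inv hN h.pow_four g with ha | ha
  · exact .inl ha
  rcases semiconjBy_self_or_inv hN h.pow_four_right g with hb | hb
  · exact .inr (.inl hb)
  · right; right
    have h1 := ha.mul_right hb
    have h2 : a⁻¹ * b⁻¹ = a * b := by
      rw [← mul_inv_rev, h.inv_left.eq, mul_inv_rev, inv_inv, h.inv_right.eq]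
    rwa [h2] at h1

/-- A subgroup of index `2` containing the centralizer of a quaternion pair is determined by
which of the two generators it contains. -/
lemma eq_of_index_two (h : IsQuaternionPair a b) (hN : ∀ H : Subgroup G, H.Normal)
    {H K : Subgroup G} (hH : H.index = 2) (hK : K.index = 2)
    (hCH : Subgroup.centralizer {a, b} ≤ H) (hCK : Subgroup.centralizer {a, b} ≤ K)
    (ha : a ∈ H ↔ a ∈ K) (hb : b ∈ H ↔ b ∈ K) : H = K := by
  ext g
  obtain ⟨c, hc, rfl | rfl | rfl | rfl⟩ := h.exists_mul_centralizer hN g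
  · simp [hCH hc, hCK hc]
  all_goals
    simp only [Subgroup.mul_mem_iff_of_index_two hH, Subgroup.mul_mem_iff_of_index_two hK,
      hCH hc, hCK hc, ha, hb]

lemma centralizer_pair_le :
    Subgroup.centralizer {a, b} ≤ Subgroup.centralizer {a} ∧
    Subgroup.centralizer {a, b} ≤ Subgroup.centralizer {b} ∧
    Subgroup.centralizer {a, b} ≤ Subgroup.centralizer {a * b} := by
  refine ⟨fun x hx => ?_, fun x hx => ?_, fun x hx => ?_⟩ <;>
    rw [mem_centralizer_pair] at hx <;> rw [mem_centralizer_singleton]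
  · exact hx.1
  · exact hx.2
  · exact hx.1.mul_right hx.2

open Classical in
lemma mem_covering_of_index_two (h : IsQuaternionPair a b) (hN : ∀ H : Subgroup G, H.Normal)
    {H : Subgroup G} (hH : H.index = 2) (hC : Subgroup.centralizer {a, b} ≤ H) :
    H ∈ ({Subgroup.centralizer {a}, Subgroup.centralizer {b},
      Subgroup.centralizer {a * b}} : Finset (Subgroup G)) := by
  have hT := h.isThreeSubgroupCovering hN
  obtain ⟨ca, cb, cab⟩ := centralizer_pair_le (a := a) (b := b)
  have iab := hT.index_eq_two (H := Subgroup.centralizer {a * b}) (by simp)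
  have haab : a ∉ Subgroup.centralizer {a * b} := fun h' => h.not_commute (by
    simpa using (Commute.refl a).inv_right.mul_right (mem_centralizer_singleton.1 h'))
  have hbab : b ∉ Subgroup.centralizer {a * b} := fun h' => h.not_commute (Commute.symm (by
    simpa using (mem_centralizer_singleton.1 h').mul_right (Commute.refl b).inv_right))
  simp only [Finset.mem_insert, Finset.mem_singleton]
  by_cases ha : a ∈ H <;> by_cases hb : b ∈ H
  · have : H = ⊤ := (Subgroup.eq_top_iff' H).2 fun g => by
      obtain ⟨c, hc, rfl | rfl | rfl | rfl⟩ := h.exists_mul_centralizer hN g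
      · exact hC hc
      · exact mul_mem ha (hC hc)
      · exact mul_mem hb (hC hc)
      · exact mul_mem (mul_mem ha hb) (hC hc)
    simp [this] at hH
  · left
    refine h.eq_of_index_two hN hH (hT.index_eq_two (by simp)) hC ca ?_ ?_
    · simp [ha, mem_centralizer_singleton]
    · simpa [hb, mem_centralizer_singleton] using fun h' => h.not_commute h'.symm
  · right; left
    refine h.eq_of_index_two hN hH (hT.index_eq_two (by simp)) hC cb ?_ ?_
    · simpa [ha, mem_centralizer_singleton] using h.not_commute
    · simp [hb, mem_centralizer_singleton]
  · right; right
    exact h.eq_of_index_two hN hH iab hC cab (by simp [ha, haab]) (by simp [hb, hbab])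

/-- Conjugation by `a` sends `b * x` to `b⁻¹ * x`, which must be `b * x` or its inverse; only the
inverse is possible, and it gives x = x⁻¹. -/
lemma sq_eq_one_of_pow_four (h : IsQuaternionPair a b) (hN : ∀ H : Subgroup G, H.Normal) {x : G}
    (hx : x ∈ Subgroup.centralizer {a, b}) (hx4 : x ^ 4 = 1) : x ^ 2 = 1 := by
  obtain ⟨xa, xb⟩ := mem_centralizer_pair.1 hx
  have h4 : (b * x) ^ 4 = 1 := by rw [xb.symm.mul_pow, h.pow_four_right, hx4, one_mul]
  rcases semiconjBy_self_or_inv hN h4 a with h1 | h1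
  · exact absurd (by simpa using Commute.mul_right h1 xa.symm.inv_right) h.not_commute
  · have h2 : SemiconjBy a (b * x) (b⁻¹ * x) := h.inv_right.mul_right xa.symm
    have h3 : b⁻¹ * x = (b * x)⁻¹ := mul_right_cancel (h2.eq.symm.trans h1.eq)
    rw [← xb.eq, mul_inv_rev] at h3
    rw [sq]
    exact mul_eq_one_iff_eq_inv.2 (mul_left_cancel h3)

lemma sq_eq_one_of_pow_two_pow (h : IsQuaternionPair a b) (hN : ∀ H : Subgroup G, H.Normal) {x : G}
    (hx : x ∈ Subgroup.centralizer {a, b}) {k : ℕ} (hk : x ^ 2 ^ k = 1) : x ^ 2 = 1 := by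
  induction k with
  | zero => simp_all
  | succ k ih =>
    cases k with
    | zero => simpa using hk
    | succ k =>
      refine ih ?_
      rw [pow_succ, pow_mul]
      refine h.sq_eq_one_of_pow_four hN (pow_mem hx _) ?_
      rw [← pow_mul, ← hk]
      congr 1
      ring

/-- A nonabelian centralizer would contain its own quaternion pair, hence an element of order 4. -/
lemma commute_of_mem_centralizer [Finite G] (h : IsQuaternionPair a b)
    (hN : ∀ H : Subgroup G, H.Normal) {x y : G} (hx : x ∈ Subgroup.centralizer {a, b})
    (hy : y ∈ Subgroup.centralizer {a, b}) : Commute x y := by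
  by_contra hxy
  have hNC : ∀ H : Subgroup (Subgroup.centralizer {a, b}), H.Normal := by
    refine fun H => ⟨fun n hn g => ?_⟩
    obtain ⟨m, hm, hmn⟩ := (hN (H.map (Subgroup.subtype _))).conj_mem n ⟨n, hn, rfl⟩ g
    have : m = g * n * g⁻¹ := Subtype.ext (by simpa using hmn)
    exact this ▸ hm
  obtain ⟨s, t, hst⟩ := exists_isQuaternionPair hNC
    ⟨⟨x, hx⟩, ⟨y, hy⟩, fun h' => hxy (congrArg Subtype.val h'.eq)⟩
  refine hst.sq_ne_one (Subtype.ext ?_)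
  exact h.sq_eq_one_of_pow_four hN s.2 (congrArg Subtype.val hst.pow_four)

/-- If the centralizer of a quaternion pair contains only one involution, then it is generated by
this involution and its elements of odd order. -/
lemma exists_odd_orderOf [Finite G] (h : IsQuaternionPair a b) (hN : ∀ H : Subgroup G, H.Normal)
    (hU : ∀ e ∈ Subgroup.centralizer {a, b}, e ^ 2 = 1 → e = 1 ∨ e = a ^ 2) {x : G}
    (hx : x ∈ Subgroup.centralizer {a, b}) :
    ∃ y ∈ Subgroup.centralizer {a, b}, Odd (orderOf y) ∧ (x = y ∨ x = a ^ 2 * y) := by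
  obtain ⟨k, m, hm, hkm⟩ := Nat.exists_eq_two_pow_mul_odd (orderOf_pos x).ne'
  have he : (x ^ m) ^ 2 = 1 := by
    refine h.sq_eq_one_of_pow_two_pow hN (pow_mem hx m) (k := k) ?_
    rw [← pow_mul, mul_comm, ← hkm, pow_orderOf_eq_one]
  rcases hU _ (pow_mem hx m) he with h1 | h1
  · exact ⟨x, hx, hm.of_dvd_nat (orderOf_dvd_of_pow_eq_one h1), .inl rfl⟩
  -- As m + 1 is even and x^(2m) = 1, the m-th power of x^(m+1) is 1.
  · refine ⟨x ^ (m + 1), pow_mem hx _, hm.of_dvd_nat (orderOf_dvd_of_pow_eq_one ?_), .inr ?_⟩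
    · obtain ⟨t, ht⟩ := hm.add_one
      rw [← pow_mul, mul_comm, pow_mul, ht, ← two_mul, pow_mul, he, one_pow]
    · rw [← h1, pow_succ, ← mul_assoc, ← sq, he, one_mul]

lemma centralizer_le_of_index_two [Finite G] (h : IsQuaternionPair a b)
    (hN : ∀ H : Subgroup G, H.Normal)
    (hU : ∀ e ∈ Subgroup.centralizer {a, b}, e ^ 2 = 1 → e = 1 ∨ e = a ^ 2) {H : Subgroup G}
    (hH : H.index = 2) : Subgroup.centralizer {a, b} ≤ H := by
  intro x hx
  obtain ⟨y, -, ⟨k, hk⟩, hy⟩ := h.exists_odd_orderOf hN hU hx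
  have hyH : y ∈ H := by
    have : y = (y ^ (k + 1)) ^ 2 := by
      rw [← pow_mul, show (k + 1) * 2 = orderOf y + 1 by omega, pow_succ, pow_orderOf_eq_one,
        one_mul]
    rw [this]
    exact Subgroup.sq_mem_of_index_two hH _
  rcases hy with rfl | rfl
  · exact hyH
  · exact mul_mem (Subgroup.sq_mem_of_index_two hH a) hyH

lemma sq_mem_centralizer (h : IsQuaternionPair a b) : a ^ 2 ∈ Subgroup.centralizer {a, b} :=
  mem_centralizer_pair.2 ⟨(Commute.refl a).pow_left 2, h.commute_sq_right⟩

/-- A product of squares is, up to `a ^ 2`, the square of an element of the centralizer. -/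
lemma exists_eq_sq_of_mem_closure_sq [Finite G] (h : IsQuaternionPair a b)
    (hN : ∀ H : Subgroup G, H.Normal) {x : G}
    (hx : x ∈ Subgroup.closure (Set.range fun g : G => g ^ 2)) :
    ∃ c ∈ Subgroup.centralizer {a, b}, x = c ^ 2 ∨ x = a ^ 2 * c ^ 2 := by
  have hz : a ^ 2 * a ^ 2 = 1 := by rw [← pow_add]; exact h.pow_four
  have hzC := h.sq_mem_centralizer
  induction hx using Subgroup.closure_induction with
  | mem x hx =>
    obtain ⟨g, rfl⟩ := hx
    obtain ⟨c, hc, hg⟩ := h.exists_mul_centralizer hN g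
    obtain ⟨ca, cb⟩ := mem_centralizer_pair.1 hc
    -- If g = qc with q among 1, a, b, ab, then g² = q²c² and q² is 1 or a².
    refine ⟨c, hc, ?_⟩
    rcases hg with rfl | rfl | rfl | rfl
    · exact .inl rfl
    · exact .inr (ca.symm.mul_pow 2)
    · exact .inr ((cb.symm.mul_pow 2).trans (by rw [h.sq_eq]))
    · exact .inr (((ca.mul_right cb).symm.mul_pow 2).trans (by rw [h.mul_sq]))
  | one => exact ⟨1, one_mem _, by simp⟩
  | mul x y _ _ hx hy =>
    obtain ⟨c, hc, hx⟩ := hx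
    obtain ⟨d, hd, hy⟩ := hy
    refine ⟨c * d, mul_mem hc hd, ?_⟩
    have hcd := h.commute_of_mem_centralizer hN hc hd
    have hzc := h.commute_of_mem_centralizer hN hzC (pow_mem hc 2)
    rw [hcd.mul_pow]
    rcases hx with rfl | rfl <;> rcases hy with rfl | rfl
    · exact .inl rfl
    · right; rw [← mul_assoc, ← hzc.eq, mul_assoc]
    · right; rw [mul_assoc]
    · left; rw [hzc.eq, mul_assoc, ← mul_assoc (a ^ 2), hz, one_mul]
  | inv x _ hx =>
    obtain ⟨c, hc, hx⟩ := hx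
    refine ⟨c⁻¹, inv_mem hc, ?_⟩
    have hzc := h.commute_of_mem_centralizer hN hzC (pow_mem hc 2)
    rcases hx with rfl | rfl
    · left; rw [inv_pow]
    · right; rw [hzc.eq, mul_inv_rev, inv_pow, inv_eq_of_mul_eq_one_right hz]

/-- If every subgroup of index `2` contains the centralizer, then the centralizer contains only one
involution. -/
lemma eq_one_or_eq_sq_of_sq_eq_one [Finite G] (h : IsQuaternionPair a b)
    (hN : ∀ H : Subgroup G, H.Normal)
    (hle : ∀ H : Subgroup G, H.index = 2 → Subgroup.centralizer {a, b} ≤ H) {e : G}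
    (he : e ∈ Subgroup.centralizer {a, b}) (he2 : e ^ 2 = 1) : e = 1 ∨ e = a ^ 2 := by
  have hmem : e ∈ Subgroup.closure (Set.range fun g : G => g ^ 2) := by
    by_contra hne
    obtain ⟨H, hH, heH⟩ := exists_index_two_of_notMem hN
      (N := Subgroup.closure (Set.range fun g : G => g ^ 2))
      (fun g => Subgroup.subset_closure ⟨g, rfl⟩) hne
    exact heH (hle H hH he)
  obtain ⟨c, hc, rfl | rfl⟩ := h.exists_eq_sq_of_mem_closure_sq hN hmem
  · left
    exact h.sq_eq_one_of_pow_four hN hc (by rw [← he2, ← pow_mul])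
  · right
    have hzc := h.commute_of_mem_centralizer hN h.sq_mem_centralizer (pow_mem hc 2)
    rw [hzc.mul_pow, ← pow_mul, ← pow_mul, h.pow_four, one_mul] at he2
    rw [h.sq_eq_one_of_pow_four hN hc he2, mul_one]

/-! ### The splitting into Q₈ and an odd part -/

lemma pow_val_add (h : IsQuaternionPair a b) (i j : ZMod (2 * 2)) :
    a ^ (i + j).val = a ^ i.val * a ^ j.val := by
  rw [ZMod.val_add, ← pow_add]
  exact (pow_eq_pow_mod _ h.pow_four).symm

lemma pow_val_sub (h : IsQuaternionPair a b) (i j : ZMod (2 * 2)) :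
    a ^ (j - i).val = (a ^ i.val)⁻¹ * a ^ j.val := by
  rw [eq_inv_mul_iff_mul_eq, ← h.pow_val_add, add_sub_cancel]

lemma pow_mul_eq (h : IsQuaternionPair a b) (n : ℕ) : a ^ n * b = b * (a ^ n)⁻¹ := by
  have := (SemiconjBy.inv_right_iff.2 h.inv_left).pow_right n
  rw [inv_inv, inv_pow] at this
  exact this.eq.symm

/-- The homomorphism from the quaternion group of order `8` given by a quaternion pair. -/
def quaternionHom (h : IsQuaternionPair a b) : QuaternionGroup 2 →* G where
  toFun q := match q with
    | .a i => a ^ i.val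
    | .xa i => b * a ^ i.val
  map_one' := by
    rw [QuaternionGroup.one_def]; simp
  map_mul' := by
    rintro (i | i) (j | j)
    · simp only [QuaternionGroup.a_mul_a, h.pow_val_add]
    · simp only [QuaternionGroup.a_mul_xa, h.pow_val_sub]
      rw [← mul_assoc, ← mul_assoc, h.pow_mul_eq]
    · simp only [QuaternionGroup.xa_mul_a, h.pow_val_add, mul_assoc]
    · simp only [QuaternionGroup.xa_mul_xa, add_sub_assoc, h.pow_val_add, h.pow_val_sub]
      rw [mul_assoc, ← mul_assoc (a ^ i.val), h.pow_mul_eq, ← mul_assoc b, ← mul_assoc b, ← sq b,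
        h.sq_eq, mul_assoc]
      rfl

lemma quaternionHom_a (h : IsQuaternionPair a b) (i : ZMod (2 * 2)) :
    h.quaternionHom (.a i) = a ^ i.val := rfl

lemma quaternionHom_xa (h : IsQuaternionPair a b) (i : ZMod (2 * 2)) :
    h.quaternionHom (.xa i) = b * a ^ i.val := rfl

lemma quaternionHom_injective (h : IsQuaternionPair a b) :
    Function.Injective h.quaternionHom := by
  rw [injective_iff_map_eq_one]
  rintro (i | i) hi
  · rw [quaternionHom_a, ← orderOf_dvd_iff_pow_eq_one, h.orderOf_left] at hi
    have := Nat.eq_zero_of_dvd_of_lt hi (ZMod.val_lt i)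
    rw [(ZMod.val_eq_zero i).1 this, QuaternionGroup.one_def]
  · rw [quaternionHom_xa] at hi
    refine absurd ?_ h.not_commute
    rw [eq_inv_of_mul_eq_one_left hi]
    exact ((Commute.refl a).pow_right _).inv_right

lemma left_mem_range (h : IsQuaternionPair a b) : a ∈ h.quaternionHom.range :=
  ⟨.a 1, by rw [quaternionHom_a, show (1 : ZMod (2 * 2)).val = 1 from rfl, pow_one]⟩

lemma right_mem_range (h : IsQuaternionPair a b) : b ∈ h.quaternionHom.range :=
  ⟨.xa 0, by simp [quaternionHom_xa]⟩

/-- The subgroup of elements of odd order of the centralizer. -/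
def oddCentralizer [Finite G] (h : IsQuaternionPair a b) (hN : ∀ H : Subgroup G, H.Normal) :
    Subgroup G where
  carrier := {x | x ∈ Subgroup.centralizer {a, b} ∧ Odd (orderOf x)}
  mul_mem' := fun {x y} hx hy => ⟨mul_mem hx.1 hy.1, (hx.2.mul hy.2).of_dvd_nat
    (h.commute_of_mem_centralizer hN hx.1 hy.1).orderOf_mul_dvd_mul_orderOf⟩
  one_mem' := ⟨one_mem _, by simp⟩
  inv_mem' := fun {x} hx => ⟨inv_mem hx.1, by simpa using hx.2⟩

lemma odd_card_oddCentralizer [Finite G] (h : IsQuaternionPair a b)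
    (hN : ∀ H : Subgroup G, H.Normal) : Odd (Nat.card (h.oddCentralizer hN)) := by
  rw [← Nat.not_even_iff_odd, even_iff_two_dvd]
  intro hd
  have := Fact.mk Nat.prime_two
  obtain ⟨x, hx⟩ := exists_prime_orderOf_dvd_card' 2 hd
  have h2 : Odd (orderOf (x : G)) := x.2.2
  rw [Subgroup.orderOf_coe, hx] at h2
  exact absurd h2 (by decide)

lemma commute_quaternionHom (h : IsQuaternionPair a b) (q : QuaternionGroup 2) {x : G}
    (hx : x ∈ Subgroup.centralizer {a, b}) : Commute (h.quaternionHom q) x := by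
  obtain ⟨xa, xb⟩ := mem_centralizer_pair.1 hx
  rcases q with i | i
  · exact xa.symm.pow_left _
  · exact xb.symm.mul_left (xa.symm.pow_left _)

/-- If the centralizer of a quaternion pair contains only one involution, then the group is the
product of a quaternion group and the elements of odd order of the centralizer. -/
lemma nonempty_mulEquiv [Finite G] (h : IsQuaternionPair a b) (hN : ∀ H : Subgroup G, H.Normal)
    (hU : ∀ e ∈ Subgroup.centralizer {a, b}, e ^ 2 = 1 → e = 1 ∨ e = a ^ 2) :
    Nonempty (G ≃* QuaternionGroup 2 × h.oddCentralizer hN) := by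
  let F : QuaternionGroup 2 × h.oddCentralizer hN →* G :=
    h.quaternionHom.noncommCoprod (h.oddCentralizer hN).subtype
      fun q x => h.commute_quaternionHom q x.2.1
  have hinj : Function.Injective F := by
    refine (MonoidHom.noncommCoprod_injective _ _ _).2
      ⟨h.quaternionHom_injective, Subtype.val_injective, ?_⟩
    rw [Subgroup.disjoint_def]
    rintro x ⟨q, rfl⟩ hx
    rw [Subgroup.range_subtype] at hx
    have h4 : h.quaternionHom q ^ 2 ^ 2 = 1 := by
      have : ∀ q : QuaternionGroup 2, q ^ 2 ^ 2 = 1 := by decide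
      rw [← map_pow, this, map_one]
    have hco : Nat.Coprime (orderOf (h.quaternionHom q)) (2 ^ 2) :=
      (Nat.coprime_two_right.2 hx.2).pow_right 2
    exact orderOf_eq_one_iff.1 (Nat.eq_one_of_dvd_coprimes hco dvd_rfl
      (orderOf_dvd_of_pow_eq_one h4))
  have hsurj : Function.Surjective F := by
    rw [← MonoidHom.range_eq_top, MonoidHom.noncommCoprod_range, Subgroup.range_subtype,
      Subgroup.eq_top_iff']
    intro g
    have ha := Subgroup.mem_sup_left (T := h.oddCentralizer hN) h.left_mem_range
    have hb := Subgroup.mem_sup_left (T := h.oddCentralizer hN) h.right_mem_range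
    obtain ⟨c, hc, hg⟩ := h.exists_mul_centralizer hN g
    obtain ⟨y, hyC, hy, hcy⟩ := h.exists_odd_orderOf hN hU hc
    have hyA := Subgroup.mem_sup_right (S := h.quaternionHom.range)
      (show y ∈ h.oddCentralizer hN from ⟨hyC, hy⟩)
    have hcA : c ∈ h.quaternionHom.range ⊔ h.oddCentralizer hN := by
      rcases hcy with rfl | rfl
      · exact hyA
      · exact mul_mem (pow_mem ha 2) hyA
    rcases hg with rfl | rfl | rfl | rfl
    · exact hcA
    · exact mul_mem ha hcA
    · exact mul_mem hb hcA
    · exact mul_mem (mul_mem ha hb) hcA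
  exact ⟨(MulEquiv.ofBijective F ⟨hinj, hsurj⟩).symm⟩

end IsQuaternionPair

/-- The product of the quaternion group of order `8` and a group of odd order contains only one
involution. -/
lemma QuaternionGroup.prod_eq_of_sq_eq_one {A : Type*} [Group A] [Finite A] (hA : Odd (Nat.card A))
    {x y : QuaternionGroup 2 × A} (hx : x ^ 2 = 1) (hx1 : x ≠ 1) (hy : y ^ 2 = 1) (hy1 : y ≠ 1) :
    x = y := by
  have key : ∀ x : QuaternionGroup 2 × A, x ^ 2 = 1 → x ≠ 1 → x = (.a 2, 1) := by
    rintro ⟨q, t⟩ h2 h1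
    have ht : t = 1 := by
      have hd : orderOf t ∣ 2 := orderOf_dvd_of_pow_eq_one (congrArg Prod.snd h2)
      exact orderOf_eq_one_iff.1 (Nat.eq_one_of_dvd_coprimes (Nat.coprime_two_right.2 hA)
        (orderOf_dvd_natCard t) hd)
    subst ht
    have hq : ∀ q : QuaternionGroup 2, q ^ 2 = 1 → q ≠ 1 → q = .a 2 := by decide
    rw [hq q (congrArg Prod.fst h2) (fun e => h1 (by rw [e]; rfl))]
  rw [key x hx hx1, key y hy hy1]

end Dedekind

/-! ### The equivalence -/

theorem corollaryF (G : Type u) [Group G] [Finite G] (hG : IsHamiltonianGroup G) :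
    (∃! S : Finset (Subgroup G), IsThreeSubgroupCovering S) ↔
      ∃ (A : Type u) (_ : CommGroup A), Finite A ∧ Odd (Nat.card A) ∧
        Nonempty (G ≃* QuaternionGroup 2 × A) := by
  classical
  obtain ⟨hnc, hN⟩ := hG
  obtain ⟨a, b, h⟩ := exists_isQuaternionPair hN hnc
  have hT := h.isThreeSubgroupCovering hN
  constructor
  · rintro ⟨S, -, hS⟩
    have hle : ∀ H : Subgroup G, H.index = 2 → Subgroup.centralizer {a, b} ≤ H := by
      intro H hH
      obtain ⟨ca, cb, cab⟩ := IsQuaternionPair.centralizer_pair_le (a := a) (b := b)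
      by_cases hHa : H = Subgroup.centralizer {a}
      · exact hHa ▸ ca
      -- H shares a covering with the centralizer of `a`; by uniqueness it is the covering by
      -- centralizers.
      · obtain ⟨S', hS', hHS'⟩ := exists_isThreeSubgroupCovering_of_index_two hH
          (hT.index_eq_two (H := Subgroup.centralizer {a}) (by simp)) hHa
        rw [hS _ hS', ← hS _ hT] at hHS'
        simp only [Finset.mem_insert, Finset.mem_singleton] at hHS'
        rcases hHS' with rfl | rfl | rfl
        exacts [ca, cb, cab]
    exact ⟨h.oddCentralizer hN,
      { (inferInstance : Group (h.oddCentralizer hN)) with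
        mul_comm := fun x y => Subtype.ext (h.commute_of_mem_centralizer hN x.2.1 y.2.1).eq },
      inferInstance, h.odd_card_oddCentralizer hN,
      h.nonempty_mulEquiv hN fun e he he2 => h.eq_one_or_eq_sq_of_sq_eq_one hN hle he he2⟩
  · rintro ⟨A, _, _, hA, ⟨φ⟩⟩
    -- Q₈ × A has one involution, and `a ^ 2` already provides it.
    have hU : ∀ e ∈ Subgroup.centralizer {a, b}, e ^ 2 = 1 → e = 1 ∨ e = a ^ 2 := by
      refine fun e _ he => or_iff_not_imp_left.2 fun he1 => φ.injective ?_
      refine QuaternionGroup.prod_eq_of_sq_eq_one hA ?_ ?_ ?_ ?_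
      · rw [← map_pow, he, map_one]
      · simpa using he1
      · rw [← map_pow, ← pow_mul, h.pow_four, map_one]
      · exact fun e => h.sq_ne_one (φ.injective (e.trans (map_one φ).symm))
    refine ⟨_, hT, fun S hS => Finset.eq_of_subset_of_card_le (fun H hH => ?_)
      (by rw [hS.1, hT.1])⟩
    have hH2 := hS.index_eq_two hH
    exact h.mem_covering_of_index_two hN hH2 (h.centralizer_le_of_index_two hN hU hH2)
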